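/- A subset $S$ of a preordered set $(\Lambda,\lesssim)$ is *convex* if $i\lesssim k\lesssim j$ with $i,j\in S$ implies $k\in S$, and *strongly convex* if every $i\in\Lambda\setminus S$ is either strictly below every element of $S$ or strictly above every element of $S$ (where $i$ is strictly below $j$ if $i\lesssim j$ and $j\not\lesssim i$). The preordered set $\Lambda$ is *$\mathbb{Z}$-like* if every finite subset is contained in a finite strongly convex subset. Let $\Lambda$ be a $\mathbb{Z}$-like preordered set and $F$ a field. A matrix $(a_{ij})_{i,j\in\Lambda}$ over $F$ is *nonsingular* if there is a finite convex $S\subseteq\Lambda$ such that $(a_{ij})_{i,j\in T}$ is invertible for every finite convex $T\supseteq S$; *upper triangular* if $a_{ij}=0$ whenever $i\not\lesssim j$; *almost upper triangular* if $a_{ij}\neq 0$ for only finitely many pairs $(i,j)$ with $i\not\lesssim j$; and *scalar* if $a_{ij}=0$ for $i\neq j$ and $a_{ii}$ does not depend on $i$. Let $\mathrm{U}_\Lambda(F)$ be the set of nonsingular upper triangular matrices, $\mathrm{AU}_\Lambda(F)$ the group, under matrix multiplication, of nonsingular almost upper triangular matrices, and $\mathrm{Z}_\Lambda(F)$ its subgroup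 of scalar matrices. For a finite convex $S\subseteq\Lambda$ let $\Lambda+S$ be the set $\Lambda$ with the preorder generated by $\lesssim$ and by declaring all elements of $S$ equivalent; then $\mathrm{U}_{\Lambda+S}(F)\subseteq\mathrm{AU}_\Lambda(F)$. For $F$ discrete, give $\mathrm{U}_{\Lambda+S}(F)$ the topology of entrywise convergence (the subspace topology of the product topology on $F^{\Lambda\times\Lambda}$) and $\mathrm{AU}_\Lambda(F)$ the direct limit topology: a subset is open if and only if its intersection with $\mathrm{U}_{\Lambda+S}(F)$ is open in $\mathrm{U}_{\Lambda+S}(F)$ for every finite convex $S$. **Theorem.** Let $F$ be a finite discrete field and let $\Lambda$ be an infinite $\mathbb{Z}$-like preordered set. Then $\mathrm{AU}_\Lambda(F)$ is a totally disconnected, locally compact topological group, and $\mathrm{Z}_\Lambda(F)$ is its unique largest proper closed normal subgroup; that is, $\mathrm{Z}_\Lambda(F)$ is a proper closed normal subgroup that contains every proper closed normal subgroup. In particular, $\mathrm{AU}_\Lambda(F)/\mathrm{Z}_\Lambda(F)$, with the quotient topology, is topologically simple: it is nontrivial and has no closed normal subgroups other than the trivial subgroup and the whole group. -/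

import Mathlib

/-- A subset `S` of a preordered set is strongly convex if every element outside `S` is either
strictly below all elements of `S` or strictly above all elements of `S`. -/
def StronglyConvex {Λ : Type*} [Preorder Λ] (S : Set Λ) : Prop :=
  ∀ i, i ∉ S → (∀ j ∈ S, i < j) ∨ (∀ j ∈ S, j < i)

/-- A preordered set is `ℤ`-like if every finite subset is contained in a finite strongly
convex subset. -/
class ZLike (Λ : Type*) [Preorder Λ] : Prop where
  exists_stronglyConvex : ∀ S : Finset Λ, ∃ T : Finset Λ, S ⊆ T ∧ StronglyConvex (T : Set Λ)

/-- The preorder `Λ + S` on `Λ` generated by the given preorder and by declaring all elements of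
`S` equivalent; see `adjoin_le_iff_reflTransGen`. -/
@[reducible] def adjoin {Λ : Type*} [Preorder Λ] (S : Finset Λ) : Preorder Λ where
  le i j := i ≤ j ∨ ∃ p ∈ S, ∃ q ∈ S, i ≤ p ∧ q ≤ j
  lt i j := (i ≤ j ∨ ∃ p ∈ S, ∃ q ∈ S, i ≤ p ∧ q ≤ j) ∧
    ¬ (j ≤ i ∨ ∃ p ∈ S, ∃ q ∈ S, j ≤ p ∧ q ≤ i)
  le_refl i := Or.inl le_rfl
  le_trans := by
    rintro i j k (h | ⟨p, hp, q, hq, h1, h2⟩) (h' | ⟨p', hp', q', hq', h1', h2'⟩)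
    · exact Or.inl (h.trans h')
    · exact Or.inr ⟨p', hp', q', hq', h.trans h1', h2'⟩
    · exact Or.inr ⟨p, hp, q, hq, h1, h2.trans h'⟩
    · exact Or.inr ⟨p, hp, q', hq', h1, h2'⟩

theorem adjoin_le_iff_reflTransGen {Λ : Type*} [Preorder Λ] (S : Finset Λ) (i j : Λ) :
    (adjoin S).le i j ↔ Relation.ReflTransGen (fun x y => x ≤ y ∨ (x ∈ S ∧ y ∈ S)) i j := by
  constructor
  · rintro (h | ⟨p, hp, q, hq, h1, h2⟩)
    · exact .single (Or.inl h)
    · exact Relation.ReflTransGen.head (b := p) (Or.inl h1)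
        (Relation.ReflTransGen.head (b := q) (Or.inr ⟨hp, hq⟩) (.single (Or.inl h2)))
  · intro h
    induction h with
    | refl => exact (adjoin S).le_refl i
    | tail _ h ih =>
      refine (adjoin S).le_trans _ _ _ ih ?_
      rcases h with h | ⟨h1, h2⟩
      · exact Or.inl h
      · exact Or.inr ⟨_, h1, _, h2, le_rfl, le_rfl⟩

section Matrices

open scoped Classical

variable {Λ R : Type*} [Preorder Λ] [CommRing R]

/-- The submatrix of `a` with rows and columns in the finite set `T`. -/
def block (a : Matrix Λ Λ R) (T : Finset Λ) : Matrix T T R :=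
  a.submatrix Subtype.val Subtype.val

/-- The matrix `a` is nonsingular if there is a finite convex set `S` such that, for every finite
convex `T ⊇ S`, the `T × T` submatrix of `a` is invertible. -/
def Nonsingular (a : Matrix Λ Λ R) : Prop :=
  ∃ S : Finset Λ, (S : Set Λ).OrdConnected ∧
    ∀ T : Finset Λ, (T : Set Λ).OrdConnected → S ⊆ T → IsUnit (block a T)

/-- Upper triangular matrices. -/
def IsUpper (a : Matrix Λ Λ R) : Prop := ∀ i j, ¬ i ≤ j → a i j = 0

/-- Almost upper triangular matrices. -/
def IsAlmostUpper (a : Matrix Λ Λ R) : Prop :=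
  {p : Λ × Λ | ¬ p.1 ≤ p.2 ∧ a p.1 p.2 ≠ 0}.Finite

/-- Scalar matrices. -/
def IsScalarMatrix {Λ R : Type*} [Zero R] (a : Matrix Λ Λ R) : Prop :=
  (∀ i j, i ≠ j → a i j = 0) ∧ ∀ i j, a i i = a j j

/-- The product of matrices with possibly infinite index set. For the matrices in `AU` below all
the sums have only finitely many nonzero terms: see `AU.finite_support_mul`. -/
noncomputable def mulM {Λ R : Type*} [CommRing R] (a b : Matrix Λ Λ R) : Matrix Λ Λ R :=
  fun i j => ∑ᶠ k, a i k * b k j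

variable (Λ R) in
/-- The set `U_Λ(R)` of nonsingular upper triangular matrices. -/
def UT : Set (Matrix Λ Λ R) := {a | Nonsingular a ∧ IsUpper a}

variable (Λ R) in
/-- The type `AU_Λ(R)` of nonsingular almost upper triangular matrices. -/
def AU : Type _ := {a : Matrix Λ Λ R // Nonsingular a ∧ IsAlmostUpper a}

theorem exists_convex [ZLike Λ] (S : Finset Λ) :
    ∃ T : Finset Λ, S ⊆ T ∧ (T : Set Λ).OrdConnected := by
  obtain ⟨T, hST, hT⟩ := ZLike.exists_stronglyConvex S
  refine ⟨T, hST, ⟨fun i hi j hj k hk => ?_⟩⟩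
  by_contra hkT
  rcases hT k hkT with h | h
  · exact (h i hi).not_ge hk.1
  · exact (h j hj).not_ge hk.2

theorem support_subset_of_upper {a b : Matrix Λ Λ R} (ha : IsUpper a) (hb : IsUpper b)
    {T : Finset Λ} (hT : (T : Set Λ).OrdConnected) {i j : Λ} (hi : i ∈ T) (hj : j ∈ T) :
    (Function.support fun k => a i k * b k j) ⊆ (T : Set Λ) := by
  intro k hk
  have h1 : i ≤ k := by
    by_contra h
    exact hk (by simp [ha i k h])
  have h2 : k ≤ j := by
    by_contra h
    exact hk (by simp [hb k j h])
  exact hT.out hi hj ⟨h1, h2⟩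

theorem mulM_apply {a b : Matrix Λ Λ R} (ha : IsUpper a) (hb : IsUpper b)
    {T : Finset Λ} (hT : (T : Set Λ).OrdConnected) {i j : Λ} (hi : i ∈ T) (hj : j ∈ T) :
    mulM a b i j = ∑ k ∈ T, a i k * b k j :=
  finsum_eq_sum_of_support_subset _ (support_subset_of_upper ha hb hT hi hj)

theorem IsUpper.mulM {a b : Matrix Λ Λ R} (ha : IsUpper a) (hb : IsUpper b) :
    IsUpper (mulM a b) := by
  intro i j hij
  refine (finsum_congr fun k => ?_).trans finsum_zero
  by_cases h : i ≤ k
  · rw [hb k j fun h' => hij (h.trans h'), mul_zero]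
  · rw [ha i k h, zero_mul]

theorem block_mulM {a b : Matrix Λ Λ R} (ha : IsUpper a) (hb : IsUpper b)
    {T : Finset Λ} (hT : (T : Set Λ).OrdConnected) :
    block (mulM a b) T = block a T * block b T := by
  ext i j
  simp only [block, Matrix.submatrix_apply, Matrix.mul_apply]
  rw [mulM_apply ha hb hT i.2 j.2, ← Finset.sum_coe_sort]

theorem ext_of_block [ZLike Λ] {a b : Matrix Λ Λ R} (S : Finset Λ)
    (h : ∀ T : Finset Λ, (T : Set Λ).OrdConnected → S ⊆ T → block a T = block b T) : a = b := by
  ext i j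
  obtain ⟨T, hT, hc⟩ := exists_convex (S ∪ {i, j})
  have := congrFun (congrFun (h T hc fun x hx => hT (by simp [hx]))
    ⟨i, hT (by simp)⟩) ⟨j, hT (by simp)⟩
  simpa [block] using this

theorem block_one (T : Finset Λ) : block (1 : Matrix Λ Λ R) T = 1 := by
  ext i j
  by_cases h : i = j
  · subst h
    simp [block]
  · rw [Matrix.one_apply_ne h]
    exact Matrix.one_apply_ne fun h' => h (Subtype.ext h')

theorem isUpper_one : IsUpper (1 : Matrix Λ Λ R) := by
  intro i j h
  rw [Matrix.one_apply_ne]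
  rintro rfl
  exact h le_rfl

theorem one_mem_UT : (1 : Matrix Λ Λ R) ∈ UT Λ R :=
  ⟨⟨∅, by simpa using Set.ordConnected_empty, fun T _ _ => by rw [block_one]; exact isUnit_one⟩,
    isUpper_one⟩

theorem mulM_mem_UT [ZLike Λ] {a b : Matrix Λ Λ R} (ha : a ∈ UT Λ R) (hb : b ∈ UT Λ R) :
    mulM a b ∈ UT Λ R := by
  obtain ⟨⟨S, -, hS⟩, ha⟩ := ha
  obtain ⟨⟨S', -, hS'⟩, hb⟩ := hb
  obtain ⟨T, hT, hc⟩ := exists_convex (S ∪ S')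
  refine ⟨⟨T, hc, fun T' hc' hT' => ?_⟩, ha.mulM hb⟩
  rw [block_mulM ha hb hc']
  exact (hS T' hc' ((Finset.subset_union_left.trans hT).trans hT')).mul
    (hS' T' hc' ((Finset.subset_union_right.trans hT).trans hT'))

theorem mulM_assoc_UT [ZLike Λ] {a b c : Matrix Λ Λ R} (ha : a ∈ UT Λ R) (hb : b ∈ UT Λ R)
    (hc : c ∈ UT Λ R) : mulM (mulM a b) c = mulM a (mulM b c) := by
  refine ext_of_block ∅ fun T hT _ => ?_
  rw [block_mulM (ha.2.mulM hb.2) hc.2 hT, block_mulM ha.2 hb.2 hT,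
    block_mulM ha.2 (hb.2.mulM hc.2) hT, block_mulM hb.2 hc.2 hT, Matrix.mul_assoc]

theorem one_mulM_UT [ZLike Λ] {a : Matrix Λ Λ R} (ha : a ∈ UT Λ R) : mulM 1 a = a := by
  refine ext_of_block ∅ fun T hT _ => ?_
  rw [block_mulM isUpper_one ha.2 hT, block_one, Matrix.one_mul]

theorem inv_block_upper {a : Matrix Λ Λ R} (ha : IsUpper a) {T : Finset Λ}
    (hu : IsUnit (block a T)) (i j : T) (hij : ¬ (i : Λ) ≤ j) : (block a T)⁻¹ i j = 0 := by
  have : Invertible (block a T) := hu.invertible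
  have hb : (block a T).BlockTriangular (fun k : T => if (i : Λ) ≤ k then (1 : ℕ) else 0) := by
    intro k l hkl
    by_cases hk : (i : Λ) ≤ k
    · by_cases hl : (i : Λ) ≤ l
      · simp [hk, hl] at hkl
      · exact ha k l fun h => hl (hk.trans h)
    · simp [hk] at hkl
  exact Matrix.blockTriangular_inv_of_blockTriangular hb (by simp [hij])

/-- Extension by zero of a finite block. -/
noncomputable def extM {Λ R : Type*} [Zero R] {T : Finset Λ} (m : Matrix T T R) : Matrix Λ Λ R :=
  fun i j => if h : i ∈ T ∧ j ∈ T then m ⟨i, h.1⟩ ⟨j, h.2⟩ else 0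

theorem block_extM {Λ R : Type*} [CommRing R] {T : Finset Λ} (m : Matrix T T R) : block (extM m) T = m := by
  ext i j
  simp [block, extM]

theorem exists_inv_UT [ZLike Λ] {a : Matrix Λ Λ R} (ha : a ∈ UT Λ R) :
    ∃ b ∈ UT Λ R, mulM b a = 1 := by
  obtain ⟨⟨S, hSc, hS⟩, ha⟩ := ha
  have key : ∀ T T' : Finset Λ, (T : Set Λ).OrdConnected → (T' : Set Λ).OrdConnected → S ⊆ T →
      T ⊆ T' → block (extM (block a T')⁻¹) T = (block a T)⁻¹ := by
    intro T T' hT hT' hST hTT'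
    have hu := hS T' hT' (hST.trans hTT')
    have hU : IsUpper (extM (block a T')⁻¹) := by
      intro i j hij
      by_cases h : i ∈ T' ∧ j ∈ T'
      · simp only [extM, h, and_self, dite_true]
        exact inv_block_upper ha hu ⟨i, h.1⟩ ⟨j, h.2⟩ hij
      · simp [extM, h]
    have h1 : block (mulM a (extM (block a T')⁻¹)) T' = 1 := by
      rw [block_mulM ha hU hT', block_extM]
      exact Matrix.mul_nonsing_inv _ ((Matrix.isUnit_iff_isUnit_det _).1 hu)
    refine (Matrix.inv_eq_right_inv ?_).symm
    rw [← block_mulM ha hU hT]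
    ext i j
    have := congrFun (congrFun h1 ⟨i, hTT' i.2⟩) ⟨j, hTT' j.2⟩
    rw [← block_one] at this ⊢
    exact this
  choose! H hH hHc using fun F : Finset Λ => exists_convex F
  let b : Matrix Λ Λ R := fun i j => extM (block a (H (S ∪ {i, j})))⁻¹ i j
  have hb : ∀ T : Finset Λ, (T : Set Λ).OrdConnected → S ⊆ T → block b T = (block a T)⁻¹ := by
    intro T hT hST
    ext i j
    have hT1 := hH (T ∪ H (S ∪ {i.1, j.1}))
    have e1 := key T _ hT (hHc _) hST (Finset.subset_union_left.trans hT1)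
    have e2 := key (H (S ∪ {i.1, j.1})) _ (hHc _) (hHc _)
      (Finset.subset_union_left.trans (hH _)) (Finset.subset_union_right.trans hT1)
    have hi : i.1 ∈ H (S ∪ {i.1, j.1}) := hH _ (by simp)
    have hj : j.1 ∈ H (S ∪ {i.1, j.1}) := hH _ (by simp)
    have e2' := congrFun (congrFun e2 ⟨i, hi⟩) ⟨j, hj⟩
    have e1' := congrFun (congrFun e1 i) j
    rw [← e1']
    simp only [block, Matrix.submatrix_apply] at e2' ⊢
    rw [e2']
    change extM (block a (H (S ∪ {i.1, j.1})))⁻¹ i.1 j.1 = _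
    rw [extM, dif_pos ⟨hi, hj⟩]
    rfl
  have hbU : IsUpper b := by
    intro i j hij
    obtain ⟨T, hT, hc⟩ := exists_convex (S ∪ {i, j})
    have hST := Finset.subset_union_left.trans hT
    have hi : i ∈ T := hT (by simp)
    have hj : j ∈ T := hT (by simp)
    have := congrFun (congrFun (hb T hc hST) ⟨i, hi⟩) ⟨j, hj⟩
    rw [inv_block_upper ha (hS T hc hST) _ _ hij] at this
    exact this
  refine ⟨b, ⟨⟨S, hSc, fun T hT hST => ?_⟩, hbU⟩, ext_of_block S fun T hT hST => ?_⟩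
  · rw [hb T hT hST]
    exact (Matrix.isUnit_nonsing_inv_iff).2 (hS T hT hST)
  · rw [block_mulM hbU ha hT, hb T hT hST, block_one]
    exact Matrix.nonsing_inv_mul _ ((Matrix.isUnit_iff_isUnit_det _).1 (hS T hT hST))

theorem zLike_adjoin [ZLike Λ] (S : Finset Λ) : @ZLike Λ (adjoin S) := by
  refine @ZLike.mk Λ (adjoin S) fun F => ?_
  obtain ⟨T, hT, hs⟩ := ZLike.exists_stronglyConvex (S ∪ F)
  have hST : ∀ p ∈ S, p ∈ T := fun p hp => hT (by simp [hp])
  refine ⟨T, Finset.subset_union_right.trans hT, fun k hk => ?_⟩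
  rcases hs k hk with h | h
  · refine Or.inl fun j hj => ((adjoin S).lt_iff_le_not_ge k j).2 ⟨Or.inl (h j hj).le, ?_⟩
    rintro (h' | ⟨p, hp, q, hq, h1, h2⟩)
    · exact (h j hj).not_ge h'
    · exact (h q (hST q hq)).not_ge h2
  · refine Or.inr fun j hj => ((adjoin S).lt_iff_le_not_ge j k).2 ⟨Or.inl (h j hj).le, ?_⟩
    rintro (h' | ⟨p, hp, q, hq, h1, h2⟩)
    · exact (h j hj).not_ge h'
    · exact (h p (hST p hp)).not_ge h1

theorem ordConnected_of_adjoin {S T : Finset Λ} (h : @Set.OrdConnected Λ (adjoin S) (T : Set Λ)) :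
    (T : Set Λ).OrdConnected :=
  ⟨fun _ hi _ hj _ hk => (@Set.OrdConnected.out Λ (adjoin S) _ h) hi hj
    ⟨Or.inl hk.1, Or.inl hk.2⟩⟩

theorem ordConnected_adjoin {S T : Finset Λ} (hST : S ⊆ T) (h : (T : Set Λ).OrdConnected) :
    @Set.OrdConnected Λ (adjoin S) (T : Set Λ) := by
  refine @Set.OrdConnected.mk Λ (adjoin S) _ ?_
  rintro i hi j hj k ⟨h1 | ⟨p, hp, q, hq, h1, h2⟩, h1' | ⟨p', hp', q', hq', h1', h2'⟩⟩
  · exact h.out hi hj ⟨h1, h1'⟩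
  · exact h.out hi (hST hp') ⟨h1, h1'⟩
  · exact h.out (hST hq) hj ⟨h2, h1'⟩
  · exact h.out (hST hq) (hST hp') ⟨h2, h1'⟩

/-- `U_{Λ+S}(R) ⊆ AU_Λ(R)`. -/
theorem mem_AU_of_mem_UT_adjoin [ZLike Λ] {S : Finset Λ} {a : Matrix Λ Λ R}
    (ha : a ∈ @UT Λ R (adjoin S) _) : Nonsingular a ∧ IsAlmostUpper a := by
  obtain ⟨⟨S₀, -, hS₀⟩, ha⟩ := ha
  constructor
  · obtain ⟨T, hT, hc⟩ := exists_convex (S ∪ S₀)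
    refine ⟨T, hc, fun T' hc' hT' => hS₀ T' (ordConnected_adjoin ?_ hc') ?_⟩
    · exact (Finset.subset_union_left.trans hT).trans hT'
    · exact (Finset.subset_union_right.trans hT).trans hT'
  · obtain ⟨T, hT, hs⟩ := ZLike.exists_stronglyConvex S
    refine (T ×ˢ T).finite_toSet.subset ?_
    rintro ⟨i, j⟩ ⟨hij, h0⟩
    have hle : (adjoin S).le i j := by
      by_contra h
      exact h0 (ha i j h)
    rcases hle with h | ⟨p, hp, q, hq, h1, h2⟩
    · exact absurd h hij
    · simp only [Finset.coe_product, Set.mem_prod, Finset.mem_coe]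
      constructor
      · by_contra hi
        rcases hs i hi with h | h
        · exact hij ((h q (hT hq)).le.trans h2)
        · exact (h p (hT hp)).not_ge h1
      · by_contra hj
        rcases hs j hj with h | h
        · exact (h q (hT hq)).not_ge h2
        · exact hij (h1.trans (h p (hT hp)).le)

/-- Every matrix in `AU_Λ(R)` lies in `U_{Λ+S}(R)` for all large `S`. -/
theorem exists_mem_UT_adjoin [ZLike Λ] {a : Matrix Λ Λ R} (h : Nonsingular a ∧ IsAlmostUpper a) :
    ∃ S₀ : Finset Λ, ∀ S, S₀ ⊆ S → a ∈ @UT Λ R (adjoin S) _ := by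
  obtain ⟨⟨S₁, -, hS₁⟩, hf⟩ := h
  rw [IsAlmostUpper] at hf
  refine ⟨hf.toFinset.image Prod.fst ∪ hf.toFinset.image Prod.snd, fun S hS => ⟨?_, ?_⟩⟩
  · obtain ⟨T, hT, hc⟩ := @exists_convex Λ (adjoin S) (zLike_adjoin S) S₁
    exact ⟨T, hc, fun T' hc' hT' => hS₁ T' (ordConnected_of_adjoin hc') (hT.trans hT')⟩
  · intro i j hij
    by_contra h0
    have hm : (i, j) ∈ hf.toFinset :=
      (Set.Finite.mem_toFinset hf).2 ⟨fun h => hij (Or.inl h), h0⟩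
    refine hij (Or.inr ⟨i, hS ?_, j, hS ?_, le_rfl, le_rfl⟩)
    · exact Finset.mem_union_left _ (Finset.mem_image_of_mem Prod.fst hm)
    · exact Finset.mem_union_right _ (Finset.mem_image_of_mem Prod.snd hm)

namespace AU

theorem finite_support_mul [ZLike Λ] (a b : AU Λ R) (i j : Λ) :
    (Function.support fun k => a.1 i k * b.1 k j).Finite := by
  obtain ⟨S, hS⟩ := exists_mem_UT_adjoin a.2
  obtain ⟨S', hS'⟩ := exists_mem_UT_adjoin b.2
  have ha := hS _ (Finset.subset_union_left (s₂ := S'))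
  have hb := hS' _ (Finset.subset_union_right (s₁ := S))
  obtain ⟨T, hT, hc⟩ := @exists_convex Λ (adjoin (S ∪ S')) (zLike_adjoin _) {i, j}
  exact T.finite_toSet.subset (@support_subset_of_upper Λ R (adjoin (S ∪ S')) _ _ _ ha.2 hb.2 _ hc
    _ _ (hT (by simp)) (hT (by simp)))

theorem mulM_mem [ZLike Λ] (a b : AU Λ R) :
    Nonsingular (mulM a.1 b.1) ∧ IsAlmostUpper (mulM a.1 b.1) := by
  obtain ⟨S, hS⟩ := exists_mem_UT_adjoin a.2
  obtain ⟨S', hS'⟩ := exists_mem_UT_adjoin b.2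
  exact mem_AU_of_mem_UT_adjoin (@mulM_mem_UT Λ R (adjoin (S ∪ S')) _ (zLike_adjoin _) _ _
    (hS _ Finset.subset_union_left) (hS' _ Finset.subset_union_right))

theorem exists_inv [ZLike Λ] (a : AU Λ R) : ∃ b : AU Λ R, mulM b.1 a.1 = 1 := by
  obtain ⟨S, hS⟩ := exists_mem_UT_adjoin a.2
  obtain ⟨b, hb, h⟩ := @exists_inv_UT Λ R (adjoin S) _ (zLike_adjoin _) _ (hS S subset_rfl)
  exact ⟨⟨b, mem_AU_of_mem_UT_adjoin hb⟩, h⟩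

noncomputable instance [ZLike Λ] : Mul (AU Λ R) := ⟨fun a b => ⟨mulM a.1 b.1, mulM_mem a b⟩⟩

noncomputable instance [ZLike Λ] : One (AU Λ R) :=
  ⟨⟨1, mem_AU_of_mem_UT_adjoin (@one_mem_UT Λ R (adjoin ∅) _)⟩⟩

noncomputable instance [ZLike Λ] : Inv (AU Λ R) := ⟨fun a => (exists_inv a).choose⟩

theorem mul_val [ZLike Λ] (a b : AU Λ R) : (a * b).1 = mulM a.1 b.1 := rfl

theorem one_val [ZLike Λ] : (1 : AU Λ R).1 = 1 := rfl

/-- `AU_Λ(R)` is a group under matrix multiplication. -/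
noncomputable instance [ZLike Λ] : Group (AU Λ R) :=
  Group.ofLeftAxioms
    (by
      intro a b c
      obtain ⟨S, hS⟩ := exists_mem_UT_adjoin a.2
      obtain ⟨S', hS'⟩ := exists_mem_UT_adjoin b.2
      obtain ⟨S'', hS''⟩ := exists_mem_UT_adjoin c.2
      exact Subtype.ext (@mulM_assoc_UT Λ R (adjoin (S ∪ S' ∪ S'')) _ (zLike_adjoin _) _ _ _
        (hS _ (Finset.subset_union_left.trans Finset.subset_union_left))
        (hS' _ (Finset.subset_union_right.trans Finset.subset_union_left))
        (hS'' _ Finset.subset_union_right)))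
    (by
      intro a
      obtain ⟨S, hS⟩ := exists_mem_UT_adjoin a.2
      exact Subtype.ext (@one_mulM_UT Λ R (adjoin S) _ (zLike_adjoin _) _ (hS _ subset_rfl)))
    (fun a => Subtype.ext (exists_inv a).choose_spec)

/-- The inclusion `U_{Λ+S}(R) → AU_Λ(R)`. -/
def ofUT [ZLike Λ] (S : Finset Λ) (u : @UT Λ R (adjoin S) _) : AU Λ R :=
  ⟨u.1, mem_AU_of_mem_UT_adjoin u.2⟩

/-- The direct limit topology on `AU_Λ(R)`: a set is open iff, for every finite convex `S`, its
intersection with `U_{Λ+S}(R)` is open in `U_{Λ+S}(R)`, where the latter carries the topology of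
entrywise convergence, that is, the subspace topology of the product topology on matrices. -/
instance [ZLike Λ] [TopologicalSpace R] : TopologicalSpace (AU Λ R) :=
  ⨆ S : {S : Finset Λ // (S : Set Λ).OrdConnected},
    TopologicalSpace.coinduced (ofUT S.1) inferInstance

end AU

theorem mulM_scalar_right {Λ R : Type*} [CommRing R] (a z : Matrix Λ Λ R) (hz : IsScalarMatrix z) (i j : Λ) :
    mulM a z i j = a i j * z j j :=
  finsum_eq_single _ j fun k hk => by rw [hz.1 k j hk, mul_zero]

theorem mulM_scalar_left {Λ R : Type*} [CommRing R] (a z : Matrix Λ Λ R) (hz : IsScalarMatrix z) (i j : Λ) :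
    mulM z a i j = z i i * a i j :=
  finsum_eq_single _ i fun k hk => by rw [hz.1 i k hk.symm, zero_mul]

variable (Λ R) in
/-- The subgroup `Z_Λ(R)` of nonsingular scalar matrices. -/
def scalarSubgroup [ZLike Λ] : Subgroup (AU Λ R) where
  carrier := {a | IsScalarMatrix a.1}
  one_mem' := by
    refine ⟨fun i j h => ?_, fun i j => ?_⟩ <;> rw [AU.one_val]
    · exact Matrix.one_apply_ne h
    · simp
  mul_mem' := by
    intro a b ha hb
    refine ⟨fun i j h => ?_, fun i j => ?_⟩ <;> rw [AU.mul_val]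
    · rw [mulM_scalar_right _ _ hb, ha.1 i j h, zero_mul]
    · rw [mulM_scalar_right _ _ hb, mulM_scalar_right _ _ hb, ha.2 i j, hb.2 i j]
  inv_mem' := by
    intro a ha
    have h : ∀ i j, (a⁻¹).1 i j * a.1 j j = (1 : Matrix Λ Λ R) i j := fun i j => by
      rw [← mulM_scalar_right _ _ ha, ← AU.mul_val, inv_mul_cancel, AU.one_val]
    have hu : ∀ j, IsUnit (a.1 j j) := fun j =>
      IsUnit.of_mul_eq_one ((a⁻¹).1 j j) (by rw [mul_comm, h j j, Matrix.one_apply_eq])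
    refine ⟨fun i j hij => (hu j).mul_left_injective ?_, fun i j => (hu j).mul_left_injective ?_⟩
    · simp only [h, zero_mul, Matrix.one_apply_ne hij]
    · have h1 := h i i
      rw [ha.2 i j] at h1
      simp only [h, h1, Matrix.one_apply_eq]

instance [ZLike Λ] : (scalarSubgroup Λ R).Normal := by
  refine ⟨fun z hz g => ?_⟩
  have : g * z = z * g := by
    apply Subtype.ext
    ext i j
    rw [AU.mul_val, AU.mul_val, mulM_scalar_right _ _ hz, mulM_scalar_left _ _ hz, hz.2 i j,
      mul_comm]
  rwa [this, mul_inv_cancel_right]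

end Matrices

/-- A topological group is topologically simple if it is nontrivial and its only closed normal
subgroups are the trivial subgroup and the whole group. -/
structure IsTopologicallySimple (G : Type*) [Group G] [TopologicalSpace G] : Prop where
  nontrivial : Nontrivial G
  eq_bot_or_eq_top : ∀ N : Subgroup G, N.Normal → IsClosed (N : Set G) → N = ⊥ ∨ N = ⊤

/-!
Let `N` be a closed normal subgroup of `AU_Λ(F)` containing a nonscalar matrix `g`. Some elementary
transvection `1 + e_pq` does not commute with `g`, and their commutator `h ∈ N` fixes every finitely
supported column vector `v` killed by two linear forms: the `q`-th coordinate and the `q`-th row of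
`g⁻¹`. Since `Λ` is infinite, such a `v ≠ 0` can moreover be chosen to avoid a prescribed coordinate
`k`, and the commutator of `h` with the transvection `1 + v e_kᵀ` is then a rank one perturbation
`1 + v φ` of the identity that lies in `N`. Taking commutators of this matrix with transvections
yields all elementary transvections, hence the groups `SL_T(F)` for all finite `T ⊆ Λ`. Their union
is dense: a finite window of a matrix in `AU_Λ(F)` extends to a matrix of determinant one, because
the determinant of a larger truncation can be corrected in a row outside the window.

For the topology, each `U_{Λ+S}(F)` is open in `AU_Λ(F)`, which reduces continuity of the group
operations to finite blocks. It is also closed in the space of all matrices, hence compact when `F`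
is finite.
-/

section Topology

open scoped Classical

variable {Λ R : Type*} [Preorder Λ] [CommRing R] [ZLike Λ]

theorem isUnit_block {a : Matrix Λ Λ R} (ha : a ∈ UT Λ R) {T : Finset Λ}
    (hT : (T : Set Λ).OrdConnected) : IsUnit (block a T) := by
  obtain ⟨b, hb, hba⟩ := exists_inv_UT ha
  exact .of_mul_eq_one_right (block b T) (by rw [← block_mulM hb.2 ha.2 hT, hba, block_one])

theorem mem_UT_iff {a : Matrix Λ Λ R} :
    a ∈ UT Λ R ↔ IsUpper a ∧ ∀ T : Finset Λ, (T : Set Λ).OrdConnected → IsUnit (block a T) :=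
  ⟨fun ha => ⟨ha.2, fun _ => isUnit_block ha⟩,
    fun ⟨ha, h⟩ => ⟨⟨∅, by simpa using Set.ordConnected_empty, fun T hT _ => h T hT⟩, ha⟩⟩

theorem continuous_block {Λ R : Type*} [TopologicalSpace R] (T : Finset Λ) :
    Continuous fun a : Matrix Λ Λ R => block a T :=
  continuous_id.matrix_submatrix _ _

theorem continuous_mulM_UT [TopologicalSpace R] [IsTopologicalSemiring R] :
    Continuous fun p : UT Λ R × UT Λ R => mulM p.1.1 p.2.1 := by
  refine continuous_matrix fun i j => ?_
  obtain ⟨T, hT, hc⟩ := exists_convex ({i, j} : Finset Λ)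
  simp only [fun p : UT Λ R × UT Λ R =>
    mulM_apply p.1.2.2 p.2.2.2 hc (i := i) (j := j) (hT (by simp)) (hT (by simp))]
  exact continuous_finsetSum _ fun k _ =>
    ((continuous_subtype_val.comp continuous_fst).matrix_elem i k).mul
      ((continuous_subtype_val.comp continuous_snd).matrix_elem k j)

section Discrete

variable [TopologicalSpace R] [DiscreteTopology R]

theorem isClosed_UT : IsClosed (UT Λ R) := by
  have hUT : UT Λ R = (⋂ (i) (j) (_ : ¬ i ≤ j), {a | a i j = 0}) ∩
      ⋂ (T : Finset Λ) (_ : (T : Set Λ).OrdConnected), {a | IsUnit (block a T)} := by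
    ext a
    simp [mem_UT_iff, IsUpper]
  rw [hUT]
  refine .inter (isClosed_iInter fun i => isClosed_iInter fun j => isClosed_iInter fun _ => ?_)
    (isClosed_iInter fun T => isClosed_iInter fun _ => ?_)
  · exact isClosed_eq (continuous_id.matrix_elem i j) continuous_const
  · exact (isClosed_discrete {m : Matrix T T R | IsUnit m}).preimage (continuous_block T)

theorem compactSpace_UT [Finite R] : CompactSpace (UT Λ R) := by
  have : CompactSpace (Matrix Λ Λ R) := inferInstanceAs (CompactSpace (Λ → Λ → R))
  exact isCompact_iff_compactSpace.1 isClosed_UT.isCompact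

theorem continuous_of_mulM_eq_one {f : UT Λ R → UT Λ R} (hf : ∀ a, mulM (f a).1 a.1 = 1) :
    Continuous f := by
  refine continuous_induced_rng.2 (continuous_matrix fun i j => ?_)
  obtain ⟨T, hT, hc⟩ := exists_convex ({i, j} : Finset Λ)
  have hinv (a : UT Λ R) : (block a.1 T)⁻¹ = block (f a).1 T :=
    Matrix.inv_eq_left_inv (by rw [← block_mulM (f a).2.2 a.2.2 hc, hf, block_one])
  have hentry : (fun a => (f a).1 i j) = fun a : UT Λ R =>
      (block a.1 T)⁻¹ ⟨i, hT (by simp)⟩ ⟨j, hT (by simp)⟩ := by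
    simp only [hinv]
    rfl
  change Continuous fun a => (f a).1 i j
  rw [hentry]
  exact (continuous_of_discreteTopology (f := fun m : Matrix T T R => m⁻¹ _ _)).comp
    ((continuous_block T).comp continuous_subtype_val)

end Discrete

theorem exists_finset_of_adjoin_le (S : Finset Λ) :
    ∃ T : Finset Λ, ∀ i j, ¬ i ≤ j → (adjoin S).le i j → i ∈ T ∧ j ∈ T := by
  obtain ⟨T, hST, hT⟩ := ZLike.exists_stronglyConvex S
  refine ⟨T, fun i j hij hle => ?_⟩
  obtain ⟨p, hp, q, hq, hip, hqj⟩ := hle.resolve_left hij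
  constructor <;> by_contra hmem
  · exact (hT i hmem).elim (fun h => hij ((h q (hST hq)).le.trans hqj))
      fun h => (h p (hST hp)).not_ge hip
  · exact (hT j hmem).elim (fun h => (h q (hST hq)).not_ge hqj)
      fun h => hij (hip.trans (h p (hST hp)).le)

namespace AU

theorem mem_UT_adjoin_of_isUpper {S : Finset Λ} (a : AU Λ R)
    (h : @IsUpper Λ R (adjoin S) _ a.1) : a.1 ∈ @UT Λ R (adjoin S) _ := by
  obtain ⟨⟨S₁, -, hS₁⟩, -⟩ := a.2
  obtain ⟨T, hT, hc⟩ := @exists_convex Λ (adjoin S) (zLike_adjoin S) S₁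
  exact ⟨⟨T, hc, fun T' hc' hT' => hS₁ T' (ordConnected_of_adjoin hc') (hT.trans hT')⟩, h⟩

theorem mul_mem_UT_adjoin {S : Finset Λ} {a b : AU Λ R} (ha : a.1 ∈ @UT Λ R (adjoin S) _)
    (hb : b.1 ∈ @UT Λ R (adjoin S) _) : (a * b).1 ∈ @UT Λ R (adjoin S) _ :=
  @mulM_mem_UT Λ R (adjoin S) _ (zLike_adjoin S) _ _ ha hb

theorem inv_mem_UT_adjoin {S : Finset Λ} {a : AU Λ R} (ha : a.1 ∈ @UT Λ R (adjoin S) _) :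
    (a⁻¹).1 ∈ @UT Λ R (adjoin S) _ := by
  obtain ⟨b, hb, hba⟩ := @exists_inv_UT Λ R (adjoin S) _ (zLike_adjoin S) _ ha
  have : ofUT S ⟨b, hb⟩ * a = 1 := Subtype.ext hba
  rwa [← eq_inv_of_mul_eq_one_left this]

theorem exists_ordConnected_mem_UT_adjoin (a b : AU Λ R) : ∃ S : Finset Λ,
    (S : Set Λ).OrdConnected ∧ a.1 ∈ @UT Λ R (adjoin S) _ ∧ b.1 ∈ @UT Λ R (adjoin S) _ := by
  obtain ⟨S, hS⟩ := exists_mem_UT_adjoin a.2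
  obtain ⟨S', hS'⟩ := exists_mem_UT_adjoin b.2
  obtain ⟨T, hT, hc⟩ := exists_convex (S ∪ S')
  exact ⟨T, hc, hS _ (Finset.union_subset_left hT), hS' _ (Finset.union_subset_right hT)⟩

section

variable [TopologicalSpace R]

theorem continuous_ofUT {S : Finset Λ} (hS : (S : Set Λ).OrdConnected) :
    Continuous (ofUT (R := R) S) :=
  continuous_iff_coinduced_le.2 (le_iSup (fun S : {S : Finset Λ // (S : Set Λ).OrdConnected} =>
    TopologicalSpace.coinduced (ofUT (R := R) S.1) inferInstance) ⟨S, hS⟩)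

theorem continuous_val : Continuous fun a : AU Λ R => a.1 :=
  continuous_iSup_dom.2 fun _ => continuous_coinduced_dom.2 continuous_subtype_val

theorem continuous_apply (i j : Λ) : Continuous fun a : AU Λ R => a.1 i j :=
  continuous_val.matrix_elem i j

theorem isEmbedding_ofUT {S : Finset Λ} (hS : (S : Set Λ).OrdConnected) :
    Topology.IsEmbedding (ofUT (R := R) S) :=
  .of_comp (continuous_ofUT hS) continuous_val .subtypeVal

theorem mem_of_eventually_eq {C : Set (AU Λ R)} (hC : IsClosed C) {S : Finset Λ}
    (hS : (S : Set Λ).OrdConnected) {a : AU Λ R} (ha : a.1 ∈ @UT Λ R (adjoin S) _) {ι : Type*}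
    {l : Filter ι} [l.NeBot] {f : ι → AU Λ R} (hf : ∀ t, (f t).1 ∈ @UT Λ R (adjoin S) _)
    (hfC : ∀ᶠ t in l, f t ∈ C) (h : ∀ i j, ∀ᶠ t in l, (f t).1 i j = a.1 i j) : a ∈ C := by
  have hlim : Filter.Tendsto (fun t => (⟨(f t).1, hf t⟩ : @UT Λ R (adjoin S) _)) l
      (nhds ⟨a.1, ha⟩) :=
    tendsto_subtype_rng.2 <| tendsto_pi_nhds.2 fun i => tendsto_pi_nhds.2 fun j =>
      tendsto_const_nhds.congr' ((h i j).mono fun _ => Eq.symm)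
  exact hC.mem_of_tendsto (((continuous_ofUT hS).tendsto _).comp hlim) hfC

theorem isClosed_scalarSubgroup [T2Space R] : IsClosed (scalarSubgroup Λ R : Set (AU Λ R)) := by
  have hscalar : (scalarSubgroup Λ R : Set (AU Λ R)) =
      (⋂ (i) (j) (_ : i ≠ j), {a | a.1 i j = 0}) ∩ ⋂ (i) (j), {a | a.1 i i = a.1 j j} := by
    ext a
    simp [scalarSubgroup, IsScalarMatrix]
  rw [hscalar]
  refine .inter (isClosed_iInter fun i => isClosed_iInter fun j => isClosed_iInter fun _ => ?_)
    (isClosed_iInter fun i => isClosed_iInter fun j => ?_)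
  · exact isClosed_eq (continuous_apply i j) continuous_const
  · exact isClosed_eq (continuous_apply i i) (continuous_apply j j)

instance [TotallyDisconnectedSpace R] : TotallyDisconnectedSpace (AU Λ R) := by
  have : TotallyDisconnectedSpace (Matrix Λ Λ R) :=
    inferInstanceAs (TotallyDisconnectedSpace (Λ → Λ → R))
  exact ⟨isTotallyDisconnected_of_image continuous_val.continuousOn Subtype.val_injective
    (isTotallyDisconnected_of_totallyDisconnectedSpace _)⟩

variable [DiscreteTopology R]

theorem isOpen_range_ofUT (S : Finset Λ) : IsOpen (Set.range (ofUT (R := R) S)) := by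
  refine isOpen_iSup_iff.2 fun S₁ => isOpen_coinduced.2 ?_
  obtain ⟨T, hT⟩ := exists_finset_of_adjoin_le S₁.1
  -- A matrix in `U_{Λ+S₁}` vanishes below the diagonal outside `T × T`, so only the entries in
  -- `T × T` decide whether it lies in `U_{Λ+S}`.
  have hpre : ofUT S₁.1 ⁻¹' Set.range (ofUT (R := R) S) =
      ⋂ i ∈ T, ⋂ j ∈ T, {u | ¬ (adjoin S).le i j → u.1 i j = 0} := by
    ext u
    simp only [Set.mem_preimage, Set.mem_iInter, Set.mem_ofPred_eq]
    constructor
    · rintro ⟨v, hv⟩ i - j - hij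
      rw [← v.2.2 i j hij]
      exact congrArg (fun x : AU Λ R => x.1 i j) hv.symm
    · refine fun hu => ⟨⟨u.1, mem_UT_adjoin_of_isUpper (ofUT S₁.1 u) fun i j hij => ?_⟩, rfl⟩
      by_cases hle : (adjoin S₁.1).le i j
      · obtain ⟨hi, hj⟩ := hT i j (fun h => hij (Or.inl h)) hle
        exact hu i hi j hj hij
      · exact u.2.2 i j hle
  rw [hpre]
  exact isOpen_biInter_finset fun i _ => isOpen_biInter_finset fun j _ =>
    (isOpen_discrete {r : R | ¬ (adjoin S).le i j → r = 0}).preimage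
      (continuous_subtype_val.matrix_elem i j)

theorem isOpenEmbedding_ofUT {S : Finset Λ} (hS : (S : Set Λ).OrdConnected) :
    Topology.IsOpenEmbedding (ofUT (R := R) S) :=
  ⟨isEmbedding_ofUT hS, isOpen_range_ofUT S⟩

instance : IsTopologicalGroup (AU Λ R) where
  continuous_mul := by
    refine continuous_iff_continuousAt.2 fun ⟨a, b⟩ => ?_
    obtain ⟨S, hS, ha, hb⟩ := exists_ordConnected_mem_UT_adjoin a b
    have hemb := isOpenEmbedding_ofUT (R := R) hS
    refine ((hemb.prodMap hemb).continuousAt_iff (x := (⟨a.1, ha⟩, ⟨b.1, hb⟩))).1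
      (Continuous.continuousAt ?_)
    exact (continuous_ofUT hS).comp (Continuous.subtype_mk
      (@continuous_mulM_UT Λ R (adjoin S) _ (zLike_adjoin S) _ _)
      fun p => mul_mem_UT_adjoin (a := ofUT S p.1) (b := ofUT S p.2) p.1.2 p.2.2)
  continuous_inv := by
    refine continuous_iff_continuousAt.2 fun a => ?_
    obtain ⟨S, hS, ha, -⟩ := exists_ordConnected_mem_UT_adjoin a a
    refine ((isOpenEmbedding_ofUT hS).continuousAt_iff (x := ⟨a.1, ha⟩)).1
      (Continuous.continuousAt ?_)
    exact (continuous_ofUT hS).comp (@continuous_of_mulM_eq_one Λ R (adjoin S) _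
      (zLike_adjoin S) _ _ (fun v => ⟨((ofUT S v)⁻¹).1, inv_mem_UT_adjoin v.2⟩)
      fun v => congrArg (fun x : AU Λ R => x.1) (inv_mul_cancel (ofUT S v)))

instance [Finite R] : LocallyCompactSpace (AU Λ R) := by
  have : WeaklyLocallyCompactSpace (AU Λ R) := by
    refine ⟨fun a => ?_⟩
    obtain ⟨S, hS, ha, -⟩ := exists_ordConnected_mem_UT_adjoin a a
    have := @compactSpace_UT Λ R (adjoin S) _ (zLike_adjoin S) _ _ _
    exact ⟨_, isCompact_range (continuous_ofUT hS), (isOpen_range_ofUT S).mem_nhds ⟨⟨a.1, ha⟩, rfl⟩⟩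
  infer_instance

end

end AU

end Topology

section Transvections

open scoped Classical

open Matrix

open scoped commutatorElement

section Matrices

variable {Λ R : Type*} [CommRing R]

theorem mulM_one_add_vecMulVec (a : Matrix Λ Λ R) (x : Λ →₀ R) (φ : Λ → R) :
    mulM a (1 + vecMulVec x φ) =
      a + vecMulVec (fun i => Finsupp.linearCombination R (a i) x) φ := by
  ext i j
  have hone : (Function.support fun k => a i k * (1 : Matrix Λ Λ R) k j) ⊆ ({j} : Finset Λ) :=
    fun k hk => by
      by_contra hkj
      exact hk (by simp [one_apply_ne (show k ≠ j by simpa using hkj)])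
  have hx : (Function.support fun k => a i k * (x k * φ j)) ⊆ x.support := fun k hk => by
    by_contra hkx
    exact hk (by simp [Finsupp.notMem_support_iff.1 hkx])
  simp only [mulM, Matrix.add_apply, vecMulVec_apply, mul_add]
  rw [finsum_add_distrib (Finset.finite_toSet _ |>.subset hone)
    (x.support.finite_toSet.subset hx), finsum_eq_sum_of_support_subset _ hone,
    finsum_eq_sum_of_support_subset _ hx, Finsupp.linearCombination_apply, Finsupp.sum,
    Finset.sum_mul]
  simp [mul_left_comm, mul_assoc]

theorem add_vecMulVec_single_mulM {a b : Matrix Λ Λ R}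
    (h : ∀ i j, (Function.support fun k => a i k * b k j).Finite) (x : Λ → R) (k : Λ) :
    mulM (a + vecMulVec x (Pi.single k 1)) b = mulM a b + vecMulVec x (b k) := by
  ext i j
  have hx : ∀ l, l ≠ k → x i * (Pi.single k 1 : Λ → R) l * b l j = 0 := fun l hl => by
    simp [Pi.single_eq_of_ne hl]
  simp only [mulM, Matrix.add_apply, vecMulVec_apply, add_mul]
  rw [finsum_add_distrib (h i j) ((Set.finite_singleton k).subset fun l hl => by
    by_contra hlk
    exact hl (hx l hlk)), finsum_eq_single _ k hx]
  simp

theorem one_add_vecMulVec_row {x φ : Λ → R} {k : Λ} (hx : x k = 0) :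
    (1 + vecMulVec x φ : Matrix Λ Λ R) k = Pi.single k 1 := by
  ext j
  simp [vecMulVec_apply, hx, one_eq_pi_single]

theorem linearCombination_eq_add_mul {x : Λ →₀ R} {r φ : Λ → R} {c : R} {i : Λ}
    (h : ∀ j, x j ≠ 0 → r j = (1 : Matrix Λ Λ R) i j + c * φ j) :
    Finsupp.linearCombination R r x = x i + c * Finsupp.linearCombination R φ x := by
  simp only [Finsupp.linearCombination_apply, Finsupp.sum, smul_eq_mul, Finset.mul_sum]
  rw [Finset.sum_congr rfl fun j hj => by rw [h j (Finsupp.mem_support_iff.1 hj), mul_add],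
    Finset.sum_add_distrib]
  simp [one_apply, mul_left_comm, eq_comm]

theorem exists_linearCombination_eq_zero [Nontrivial R] [Infinite Λ] (φ : Λ → R) (s : Finset Λ) :
    ∃ x : Λ →₀ R, x ≠ 0 ∧ (∀ i ∈ s, x i = 0) ∧ Finsupp.linearCombination R φ x = 0 := by
  obtain ⟨p, hp⟩ := Infinite.exists_notMem_finset s
  obtain ⟨q, hq⟩ := Infinite.exists_notMem_finset (insert p s)
  simp only [Finset.mem_insert, not_or] at hq
  have hne {i r : Λ} (hi : i ∈ s) (hr : r ∉ s) : i ≠ r := ne_of_mem_of_not_mem hi hr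
  by_cases hφ : φ p = 0
  · refine ⟨Finsupp.single p 1, by simp, fun i hi => Finsupp.single_eq_of_ne (hne hi hp), ?_⟩
    simp [hφ]
  · refine ⟨Finsupp.single p (φ q) - Finsupp.single q (φ p), fun h => hφ ?_, fun i hi => ?_, ?_⟩
    · simpa [Finsupp.single_eq_of_ne hq.1] using DFunLike.congr_fun h q
    · simp [Finsupp.single_eq_of_ne (hne hi hp), Finsupp.single_eq_of_ne (hne hi hq.2)]
    · simp [mul_comm]

end Matrices

namespace AU

section Ring

variable {Λ R : Type*} [Preorder Λ] [CommRing R]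

theorem isUnit_block_one_add_vecMulVec {x : Λ →₀ R} {k : Λ} (hx : x k = 0) (T : Finset Λ) :
    IsUnit (block (1 + vecMulVec x (Pi.single k 1)) T) := by
  set m := vecMulVec (fun i : T => x i) (fun j : T => (Pi.single k 1 : Λ → R) j) with hm
  have hdot : (fun j : T => (Pi.single k 1 : Λ → R) j) ⬝ᵥ (fun i : T => x i) = 0 :=
    Finset.sum_eq_zero fun i _ => by
      rcases eq_or_ne i.1 k with hik | hik
      · simp [hik, hx]
      · simp [Pi.single_eq_of_ne hik]
  have hsq : m ^ 2 = 0 := by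
    rw [sq, hm, vecMulVec_mul_vecMulVec, hdot, zero_smul, vecMulVec_zero]
  have hblock : block (1 + vecMulVec x (Pi.single k 1)) T = 1 + m := by
    rw [← block_one]
    rfl
  rw [hblock]
  exact IsNilpotent.isUnit_one_add ⟨2, hsq⟩

/-- The transvection `1 + x eₖᵀ`, where `x` is a finitely supported column vector with `x k = 0`. -/
noncomputable def transvection (x : Λ →₀ R) (k : Λ) (hx : x k = 0) : AU Λ R :=
  ⟨1 + vecMulVec x (Pi.single k 1),
    ⟨∅, by simpa using Set.ordConnected_empty, fun T _ _ => isUnit_block_one_add_vecMulVec hx T⟩,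
    (x.support ×ˢ {k}).finite_toSet.subset fun ⟨i, j⟩ ⟨hij, h⟩ => by
      rw [Matrix.add_apply, one_apply_ne fun h => hij h.le, zero_add, vecMulVec_apply] at h
      have hjk : j = k := by
        by_contra hjk
        exact h (by rw [Pi.single_eq_of_ne hjk, mul_zero])
      simpa [hjk] using left_ne_zero_of_mul h⟩

theorem transvection_val (x : Λ →₀ R) (k : Λ) (hx : x k = 0) :
    (transvection x k hx).1 = 1 + vecMulVec x (Pi.single k 1) := rfl

/-- The elementary transvection `1 + c eᵢⱼ`. -/
noncomputable def elementary (i j : Λ) (hij : i ≠ j) (c : R) : AU Λ R :=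
  transvection (Finsupp.single i c) j (Finsupp.single_eq_of_ne' hij)

variable [ZLike Λ]

theorem mul_transvection_val (g : AU Λ R) (x : Λ →₀ R) (k : Λ) (hx : x k = 0) :
    (g * transvection x k hx).1 =
      g.1 + vecMulVec (fun i => Finsupp.linearCombination R (g.1 i) x) (Pi.single k 1) :=
  mulM_one_add_vecMulVec ..

theorem transvection_mul_val (g : AU Λ R) (x : Λ →₀ R) (k : Λ) (hx : x k = 0) :
    (transvection x k hx * g).1 = g.1 + vecMulVec x (g.1 k) := by
  have h := add_vecMulVec_single_mulM (finite_support_mul 1 g) x k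
  rwa [← mul_val, one_mul] at h

theorem mul_transvection_mul_inv_val (g : AU Λ R) (x : Λ →₀ R) (k : Λ) (hx : x k = 0) :
    (g * transvection x k hx * g⁻¹).1 =
      1 + vecMulVec (fun i => Finsupp.linearCombination R (g.1 i) x) ((g⁻¹).1 k) := by
  rw [mul_val, mul_transvection_val, add_vecMulVec_single_mulM (finite_support_mul g g⁻¹),
    ← mul_val, mul_inv_cancel, one_val]

theorem transvection_mul_transvection {x y : Λ →₀ R} {k : Λ} (hx : x k = 0) (hy : y k = 0) :
    transvection x k hx * transvection y k hy = transvection (x + y) k (by simp [hx, hy]) := by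
  refine Subtype.ext ?_
  rw [transvection_mul_val, transvection_val, transvection_val, one_add_vecMulVec_row hy, add_assoc,
    ← add_vecMulVec, Finsupp.coe_add, add_comm (y : Λ → R)]

theorem transvection_inv {x : Λ →₀ R} {k : Λ} (hx : x k = 0) :
    (transvection x k hx)⁻¹ = transvection (-x) k (by simp [hx]) := by
  refine inv_eq_of_mul_eq_one_right (Subtype.ext ?_)
  simp [transvection_mul_transvection, transvection_val, one_val]

theorem commutator_transvection {g : AU Λ R} {x : Λ →₀ R} {φ : Λ → R}
    (hg : g.1 = 1 + vecMulVec x φ) {y : Λ →₀ R} {k : Λ} (hx : x k = 0) (hy : y k = 0) :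
    ⁅g, transvection y k hy⁆ =
      transvection (Finsupp.linearCombination R φ y • x) k (by simp [hx]) := by
  have hrow : g.1 k = Pi.single k 1 := by rw [hg, one_add_vecMulVec_row hx]
  rw [commutatorElement_def, mul_inv_eq_iff_eq_mul, mul_inv_eq_iff_eq_mul,
    transvection_mul_transvection]
  refine Subtype.ext ?_
  rw [mul_transvection_val, transvection_mul_val, hrow]
  congr 2
  ext i
  rw [linearCombination_eq_add_mul (c := x i) (φ := φ) fun j _ => by rw [hg]; rfl]
  simp [mul_comm, add_comm]

theorem linearCombination_commutator_transvection (g : AU Λ R) {x v : Λ →₀ R} {k : Λ}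
    (hx : x k = 0) (hvk : v k = 0) (hv : Finsupp.linearCombination R ((g⁻¹).1 k) v = 0) (i : Λ) :
    Finsupp.linearCombination R (⁅g, transvection x k hx⁆.1 i) v = v i := by
  rw [commutatorElement_def, transvection_inv, mul_transvection_val,
    mul_transvection_mul_inv_val]
  refine (linearCombination_eq_add_mul (c := Finsupp.linearCombination R (g.1 i) x)
    (φ := (g⁻¹).1 k) fun j hj => ?_).trans (by rw [hv, mul_zero, add_zero])
  have hjk : j ≠ k := fun h => hj (h ▸ hvk)
  simp [vecMulVec_apply, Pi.single_eq_of_ne hjk]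

theorem commutator_transvection_inv_val {h : AU Λ R} {v : Λ →₀ R} {k : Λ} (hvk : v k = 0)
    (hv : ∀ i, Finsupp.linearCombination R (h.1 i) v = v i) :
    ⁅(transvection v k hvk)⁻¹, h⁆.1 = 1 + vecMulVec v ((h⁻¹).1 k - Pi.single k 1) := by
  rw [commutatorElement_def, inv_inv, mul_assoc, mul_assoc, ← mul_assoc h, transvection_inv,
    transvection_mul_val, mul_transvection_mul_inv_val]
  ext i j
  simp [hv, hvk, vecMulVec_apply, one_eq_pi_single]
  ring

theorem mem_scalarSubgroup_of_commute {g : AU Λ R}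
    (h : ∀ i j (hij : i ≠ j), Commute g (elementary i j hij 1)) : g ∈ scalarSubgroup Λ R := by
  have hcol (i j a) (hij : i ≠ j) : g.1 a i = (Pi.single i (g.1 j j) : Λ → R) a := by
    have := congrArg (fun u : AU Λ R => u.1 a j) (h i j hij).eq
    simpa [elementary, mul_transvection_val, transvection_mul_val, vecMulVec_apply,
      Pi.single_apply, Finsupp.single_apply, eq_comm] using this
  refine ⟨fun a i hai => ?_, fun i j => ?_⟩
  · rw [hcol i a a hai.symm, Pi.single_eq_of_ne hai]
  · rcases eq_or_ne i j with rfl | hij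
    · rfl
    · rw [hcol i j i hij, Pi.single_eq_same]

end Ring

section Field

variable {Λ F : Type*} [Preorder Λ] [ZLike Λ] [Field F] {N : Subgroup (AU Λ F)}
  [N.Normal]

theorem elementary_mem_of_apply_ne_zero {x : Λ →₀ F} {k l p : Λ} {hx : x k = 0}
    (h : transvection x k hx ∈ N) (hp : x p ≠ 0) (hlk : l ≠ k) (hlp : l ≠ p) (c : F) :
    elementary l k hlk c ∈ N := by
  have hmem := Subgroup.commutator_le_right ⊤ N
    (Subgroup.commutator_mem_commutator (Subgroup.mem_top (elementary l p hlp (c / x p))) h)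
  have hcomm := commutator_transvection (g := elementary l p hlp (c / x p)) rfl
    (Finsupp.single_eq_of_ne' hlk) hx
  have hval : Finsupp.linearCombination F (Pi.single p (1 : F)) x = x p := by
    simp [Finsupp.linearCombination_apply, Finsupp.sum, Pi.single_apply, eq_comm]
  rw [hcomm, hval] at hmem
  simpa [elementary, mul_div_cancel₀ _ hp] using hmem

theorem elementary_mem_of_elementary_mem {l k k' : Λ} {hlk : l ≠ k} {c : F}
    (h : elementary l k hlk c ∈ N) (hlk' : l ≠ k') (hkk' : k ≠ k') :
    elementary l k' hlk' c ∈ N := by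
  have hmem := Subgroup.commutator_le_left N ⊤
    (Subgroup.commutator_mem_commutator h (Subgroup.mem_top (elementary k k' hkk' 1)))
  have hcomm : ⁅elementary l k hlk c, elementary k k' hkk' (1 : F)⁆ = _ :=
    commutator_transvection (φ := Pi.single k 1) rfl (Finsupp.single_eq_of_ne' hlk')
      (Finsupp.single_eq_of_ne' hkk')
  rw [hcomm] at hmem
  simpa [elementary] using hmem

variable [Infinite Λ]

theorem elementary_mem_of_transvection_mem {x : Λ →₀ F} {k : Λ} {hx : x k = 0}
    (h : transvection x k hx ∈ N) (hx0 : x ≠ 0) {i j : Λ} (hij : i ≠ j) (c : F) :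
    elementary i j hij c ∈ N := by
  obtain ⟨p, hp⟩ := Finsupp.ne_iff.1 hx0
  obtain ⟨l, hl⟩ := Infinite.exists_notMem_finset ({k, p, i, j} : Finset Λ)
  simp only [Finset.mem_insert, Finset.mem_singleton, not_or] at hl
  obtain ⟨hlk, hlp, hli, hlj⟩ := hl
  have hk : elementary l k hlk 1 ∈ N := elementary_mem_of_apply_ne_zero h hp hlk hlp 1
  have hj : elementary l j hlj 1 ∈ N := by
    rcases eq_or_ne k j with rfl | hkj
    · exact hk
    · exact elementary_mem_of_elementary_mem hk hlj hkj
  exact elementary_mem_of_apply_ne_zero hj (p := l) (by simp) hij (Ne.symm hli) c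

theorem elementary_mem_of_one_add_vecMulVec_mem {g : AU Λ F} (hg : g ∈ N) {x : Λ →₀ F}
    {φ : Λ → F} (hgx : g.1 = 1 + vecMulVec x φ) (hx : x ≠ 0) (hφ : φ ≠ 0) {i j : Λ}
    (hij : i ≠ j) (c : F) : elementary i j hij c ∈ N := by
  obtain ⟨p, hp⟩ := Function.ne_iff.1 hφ
  obtain ⟨k, hk⟩ := Infinite.exists_notMem_finset (insert p x.support)
  simp only [Finset.mem_insert, not_or, Finsupp.notMem_support_iff] at hk
  have hmem := Subgroup.commutator_le_left N ⊤ (Subgroup.commutator_mem_commutator hg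
    (Subgroup.mem_top (elementary p k (Ne.symm hk.1) 1)))
  rw [elementary, commutator_transvection hgx hk.2] at hmem
  exact elementary_mem_of_transvection_mem hmem (smul_ne_zero (by simpa using hp) hx) hij c

theorem elementary_mem_of_notMem_scalarSubgroup {g : AU Λ F} (hgN : g ∈ N)
    (hg : g ∉ scalarSubgroup Λ F) {i j : Λ} (hij : i ≠ j) (c : F) : elementary i j hij c ∈ N := by
  obtain ⟨p, q, hpq, hcomm⟩ : ∃ p q, ∃ hpq : p ≠ q,
      ¬ Commute g (elementary p q hpq 1) := by
    by_contra! H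
    exact hg (mem_scalarSubgroup_of_commute H)
  set h := ⁅g, elementary p q hpq (1 : F)⁆
  have hhN : h ∈ N := Subgroup.commutator_le_left N ⊤
    (Subgroup.commutator_mem_commutator hgN (Subgroup.mem_top _))
  have hh1 : h⁻¹.1 ≠ 1 := fun H =>
    hcomm (commutatorElement_eq_one_iff_mul_comm.1 (inv_eq_one.1 (Subtype.ext H)))
  obtain ⟨k, hk⟩ : ∃ k, h⁻¹.1 k - Pi.single k 1 ≠ 0 := by
    by_contra! H
    exact hh1 (funext fun k => (sub_eq_zero.1 (H k)).trans (funext fun _ => one_eq_pi_single.symm))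
  obtain ⟨v, hv0, hvs, hv⟩ := exists_linearCombination_eq_zero (g⁻¹.1 q) {q, k}
  have hvk : v k = 0 := hvs k (by simp)
  have hfix (a : Λ) : Finsupp.linearCombination F (h.1 a) v = v a :=
    linearCombination_commutator_transvection g _ (hvs q (by simp)) hv a
  exact elementary_mem_of_one_add_vecMulVec_mem
    (Subgroup.commutator_le_right ⊤ N (Subgroup.commutator_mem_commutator (Subgroup.mem_top _) hhN))
    (commutator_transvection_inv_val hvk hfix) hv0 hk hij c

end Field

end AU

end Transvections

section SpecialLinearGroup

open Matrix SpecialLinearGroup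

variable {ι F : Type*} [Fintype ι] [DecidableEq ι] [Field F]

-- With `w a = eᵢⱼ(a) eⱼᵢ(-a⁻¹) eᵢⱼ(a)`, which is antidiagonal, the product is `w a * w (-1)`.
theorem diag2n_eq_mul_transvection {i j : ι} (hij : i ≠ j) {a : F} (ha : a ≠ 0) :
    diag2n hij a ha =
      SpecialLinearGroup.transvection hij a * SpecialLinearGroup.transvection hij.symm (-a⁻¹) *
      SpecialLinearGroup.transvection hij a * SpecialLinearGroup.transvection hij (-1) *
      SpecialLinearGroup.transvection hij.symm 1 * SpecialLinearGroup.transvection hij (-1) := by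
  refine Subtype.ext ?_
  have hdiag : (diag2n hij a ha).1 = 1 + single i i (a - 1) + single j j (a⁻¹ - 1) := by
    ext k l
    rw [diag2n_coe]
    rcases eq_or_ne k l with rfl | hkl
    · simp only [diagonal_apply_eq, Matrix.add_apply, one_apply_eq, single_apply, and_self]
      grind
    · simp only [diagonal_apply_ne _ hkl, Matrix.add_apply, one_apply_ne hkl, single_apply]
      grind
  ext k l
  simp [hdiag, transvection_coe, mul_add, add_mul, hij, hij.symm, single_mul_single_of_ne, ha,
    single_apply, one_apply]
  grind

theorem eq_top_of_transvection_mem {H : Subgroup (SpecialLinearGroup ι F)}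
    (h : ∀ i j (hij : i ≠ j) (c : F), SpecialLinearGroup.transvection hij c ∈ H) : H = ⊤ := by
  refine eq_top_iff.2 fun A _ => ?_
  rcases subsingleton_or_nontrivial ι with _ | _
  · rw [Subsingleton.elim A 1]
    exact H.one_mem
  · refine diagonal_transvection_induction' (· ∈ H) A (fun i j hij a ha => ?_) h
      fun _ _ => H.mul_mem
    rw [diag2n_eq_mul_transvection hij ha]
    exact H.mul_mem (H.mul_mem (H.mul_mem (H.mul_mem (H.mul_mem (h ..) (h ..)) (h ..)) (h ..))
      (h ..)) (h ..)

end SpecialLinearGroup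

section Density

open scoped Classical

section Matrices

variable {Λ R : Type*} [CommRing R] {T : Finset Λ}

/-- The matrix that agrees with `A` on `T × T` and with the identity matrix elsewhere. -/
noncomputable def extendMatrix (A : Matrix T T R) : Matrix Λ Λ R :=
  fun i j => if h : i ∈ T ∧ j ∈ T then A ⟨i, h.1⟩ ⟨j, h.2⟩ else (1 : Matrix Λ Λ R) i j

theorem extendMatrix_of_mem (A : Matrix T T R) {i j : Λ} (hi : i ∈ T) (hj : j ∈ T) :
    extendMatrix A i j = A ⟨i, hi⟩ ⟨j, hj⟩ :=
  dif_pos ⟨hi, hj⟩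

theorem extendMatrix_of_notMem (A : Matrix T T R) {i j : Λ} (h : ¬ (i ∈ T ∧ j ∈ T)) :
    extendMatrix A i j = (1 : Matrix Λ Λ R) i j :=
  dif_neg h

theorem extendMatrix_one : extendMatrix (1 : Matrix T T R) = 1 := by
  ext i j
  by_cases h : i ∈ T ∧ j ∈ T
  · simp [extendMatrix_of_mem _ h.1 h.2, Matrix.one_apply]
  · exact extendMatrix_of_notMem _ h

theorem extendMatrix_eq_zero_of_notMem (A : Matrix T T R) {i j : Λ} (h : ¬ (i ∈ T ∧ j ∈ T))
    (hij : i ≠ j) : extendMatrix A i j = 0 := by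
  rw [extendMatrix_of_notMem A h, Matrix.one_apply_ne hij]

theorem support_extendMatrix_mul_subset {T' : Finset Λ} (hTT' : T ⊆ T') (A B : Matrix T T R)
    {i : Λ} (hi : i ∈ T') (j : Λ) :
    (Function.support fun k => extendMatrix A i k * extendMatrix B k j) ⊆ T' := fun k hk => by
  by_contra hkT
  exact hk (by simp [extendMatrix_eq_zero_of_notMem A (fun h => hkT (hTT' h.2))
    (ne_of_mem_of_not_mem hi hkT)])

theorem mulM_extendMatrix (A B : Matrix T T R) :
    mulM (extendMatrix A) (extendMatrix B) = extendMatrix (A * B) := by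
  ext i j
  by_cases hi : i ∈ T
  · by_cases hj : j ∈ T
    · rw [mulM, finsum_eq_sum_of_support_subset _
        (support_extendMatrix_mul_subset subset_rfl A B hi j), extendMatrix_of_mem _ hi hj,
        Matrix.mul_apply, ← Finset.sum_coe_sort]
      simp only [extendMatrix_of_mem A hi (Subtype.prop _),
        extendMatrix_of_mem B (Subtype.prop _) hj]
    · have hT (k : Λ) : ¬ (k ∈ T ∧ j ∈ T) := fun h => hj h.2
      rw [mulM, finsum_eq_single _ j fun k hk => by
        rw [extendMatrix_eq_zero_of_notMem B (hT k) hk, mul_zero]]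
      simp [extendMatrix_of_notMem _ (hT _)]
  · have hT (k : Λ) : ¬ (i ∈ T ∧ k ∈ T) := fun h => hi h.1
    rw [mulM, finsum_eq_single _ i fun k hk => by
      rw [extendMatrix_eq_zero_of_notMem A (hT k) hk.symm, zero_mul]]
    simp [extendMatrix_of_notMem _ (hT _)]

theorem block_mulM_extendMatrix {T' : Finset Λ} (hTT' : T ⊆ T') (A B : Matrix T T R) :
    block (mulM (extendMatrix A) (extendMatrix B)) T' =
      block (extendMatrix A) T' * block (extendMatrix B) T' := by
  ext i j
  simp only [block, Matrix.submatrix_apply, Matrix.mul_apply]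
  rw [mulM, finsum_eq_sum_of_support_subset _
    (support_extendMatrix_mul_subset hTT' A B i.2 j), ← Finset.sum_coe_sort]

theorem extendMatrix_transvection {i j : T} (hij : i ≠ j) (c : R) :
    extendMatrix (Matrix.SpecialLinearGroup.transvection hij c).1 =
      1 + Matrix.vecMulVec (Finsupp.single i.1 c) (Pi.single j.1 1) := by
  ext a b
  by_cases h : a ∈ T ∧ b ∈ T
  · rw [extendMatrix_of_mem _ h.1 h.2]
    simp [Matrix.SpecialLinearGroup.transvection_coe, Matrix.one_apply, Matrix.single_apply,
      Matrix.vecMulVec_apply, Finsupp.single_apply, Pi.single_apply, Subtype.ext_iff]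
    grind
  · rw [extendMatrix_of_notMem _ h]
    simp [Matrix.vecMulVec_apply, Finsupp.single_apply, Pi.single_apply]
    grind

end Matrices

namespace AU

section Ring

variable {Λ R : Type*} [Preorder Λ] [CommRing R] {T : Finset Λ}

theorem isAlmostUpper_extendMatrix (A : Matrix T T R) : IsAlmostUpper (extendMatrix A) := by
  refine (T ×ˢ T).finite_toSet.subset fun ⟨i, j⟩ ⟨hij, h⟩ => ?_
  by_contra hT
  exact h (extendMatrix_eq_zero_of_notMem A (by simpa using hT) fun h => hij h.le)

variable [ZLike Λ]

theorem nonsingular_extendMatrix {A : Matrix T T R} (hA : IsUnit A) :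
    Nonsingular (extendMatrix A) := by
  obtain ⟨S, hTS, hS⟩ := exists_convex T
  obtain ⟨B, hAB⟩ := hA.exists_right_inv
  refine ⟨S, hS, fun T' _ hST' => .of_mul_eq_one (block (extendMatrix B) T') ?_⟩
  rw [← block_mulM_extendMatrix (hTS.trans hST'), mulM_extendMatrix, hAB, extendMatrix_one,
    block_one]

/-- The embedding of `SL_T(R)` into `AU_Λ(R)` that extends a matrix by the identity. -/
noncomputable def extend : Matrix.SpecialLinearGroup T R →* AU Λ R where
  toFun A := ⟨extendMatrix A.1,
    nonsingular_extendMatrix ((Matrix.isUnit_iff_isUnit_det _).2 (by simp [A.2])),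
    isAlmostUpper_extendMatrix _⟩
  map_one' := Subtype.ext extendMatrix_one
  map_mul' A B := Subtype.ext (mulM_extendMatrix A.1 B.1).symm

theorem extend_val (A : Matrix.SpecialLinearGroup T R) : (extend A).1 = extendMatrix A.1 := rfl

theorem extend_transvection {i j : T} (hij : i ≠ j) (c : R) :
    extend (Matrix.SpecialLinearGroup.transvection hij c) =
      elementary i.1 j.1 (Subtype.coe_ne_coe.2 hij) c :=
  Subtype.ext (extendMatrix_transvection hij c)

theorem extend_mem_UT_adjoin {S : Finset Λ} {a : Matrix Λ Λ R} (ha : @IsUpper Λ R (adjoin S) _ a)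
    {A : Matrix.SpecialLinearGroup T R} (hA : ∀ i j : T, a i j = 0 → A.1 i j = 0) :
    (extend A).1 ∈ @UT Λ R (adjoin S) _ := by
  refine mem_UT_adjoin_of_isUpper _ fun i j hij => ?_
  rw [extend_val]
  by_cases hT : i ∈ T ∧ j ∈ T
  · rw [extendMatrix_of_mem _ hT.1 hT.2]
    exact hA _ _ (ha i j hij)
  · refine extendMatrix_eq_zero_of_notMem _ hT ?_
    rintro rfl
    exact hij ((adjoin S).le_refl i)

theorem exists_extend_eq_on [Infinite Λ] {S : Finset Λ} {a : AU Λ R}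
    (ha : a.1 ∈ @UT Λ R (adjoin S) _) (T₀ : Finset Λ) :
    ∃ (T : Finset Λ) (A : Matrix.SpecialLinearGroup T R),
      (extend A).1 ∈ @UT Λ R (adjoin S) _ ∧
        ∀ i ∈ T₀, ∀ j ∈ T₀, (extend A).1 i j = a.1 i j := by
  obtain ⟨t, ht⟩ := Infinite.exists_notMem_finset T₀
  obtain ⟨T, hT, hc⟩ := exists_convex (S ∪ insert t T₀)
  have hT₀ {i} (hi : i ∈ T₀) : i ∈ T := hT (by simp [hi])
  have htT : t ∈ T := hT (by simp)
  have hdet : IsUnit (block a.1 T).det := (Matrix.isUnit_iff_isUnit_det _).1 <|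
    @isUnit_block Λ R (adjoin S) _ (zLike_adjoin S) _ ha _
      (ordConnected_adjoin (Finset.union_subset_left hT) hc)
  -- Rescaling the row `t ∉ T₀` corrects the determinant without changing the window `T₀ × T₀`.
  let A : Matrix.SpecialLinearGroup T R :=
    ⟨(block a.1 T).updateRow ⟨t, htT⟩ (hdet.unit⁻¹.1 • block a.1 T ⟨t, htT⟩), by
      rw [Matrix.det_updateRow_smul, Matrix.updateRow_eq_self, hdet.val_inv_mul]⟩
  refine ⟨T, A, extend_mem_UT_adjoin ha.2 fun i j hij => ?_, fun i hi j hj => ?_⟩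
  · rcases eq_or_ne i ⟨t, htT⟩ with rfl | hit
    · simp [A, block, hij]
    · simp [A, block, Matrix.updateRow_ne hit, hij]
  · have hit : (⟨i, hT₀ hi⟩ : T) ≠ ⟨t, htT⟩ := fun h =>
      ne_of_mem_of_not_mem hi ht (congrArg Subtype.val h)
    rw [extend_val, extendMatrix_of_mem _ (hT₀ hi) (hT₀ hj)]
    simp [A, block, Matrix.updateRow_ne hit]

end Ring

section Field

variable {Λ F : Type*} [Preorder Λ] [ZLike Λ] [Field F] {N : Subgroup (AU Λ F)}

theorem extend_mem_of_elementary_mem (hN : ∀ i j (hij : i ≠ j) c, elementary i j hij c ∈ N)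
    {T : Finset Λ} (A : Matrix.SpecialLinearGroup T F) : extend A ∈ N := by
  have htop : N.comap (extend (T := T)) = ⊤ := eq_top_of_transvection_mem fun i j hij c => by
    rw [Subgroup.mem_comap, extend_transvection]
    exact hN ..
  exact Subgroup.mem_comap.1 (htop ▸ Subgroup.mem_top A)

theorem eq_top_of_elementary_mem [Infinite Λ] [TopologicalSpace F]
    (hN : ∀ i j (hij : i ≠ j) c, elementary i j hij c ∈ N)
    (hclosed : IsClosed (N : Set (AU Λ F))) : N = ⊤ := by
  refine eq_top_iff.2 fun a _ => ?_
  obtain ⟨S, hS, ha, -⟩ := exists_ordConnected_mem_UT_adjoin a a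
  choose T A hUT hA using exists_extend_eq_on ha
  refine mem_of_eventually_eq hclosed hS ha (l := Filter.atTop) hUT
    (.of_forall fun T₀ => extend_mem_of_elementary_mem hN (A T₀)) fun i j => ?_
  filter_upwards [Filter.eventually_ge_atTop ({i, j} : Finset Λ)] with T₀ hT₀
  exact hA T₀ i (hT₀ (by simp)) j (hT₀ (by simp))

end Field

end AU

end Density

section Main

variable {Λ : Type*} [Preorder Λ] [ZLike Λ]

theorem scalarSubgroup_ne_top {R : Type*} [CommRing R] [Nontrivial Λ] [Nontrivial R] :
    scalarSubgroup Λ R ≠ ⊤ := fun h => by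
  obtain ⟨i, j, hij⟩ := exists_pair_ne Λ
  have hmem : AU.elementary i j hij (1 : R) ∈ scalarSubgroup Λ R := h ▸ Subgroup.mem_top _
  simpa [AU.elementary, AU.transvection_val, Matrix.vecMulVec_apply, hij] using hmem.1 i j hij

theorem isGreatest_scalarSubgroup {F : Type*} [Infinite Λ] [Field F] [TopologicalSpace F]
    [T2Space F] :
    IsGreatest {N : Subgroup (AU Λ F) | N ≠ ⊤ ∧ N.Normal ∧ IsClosed (N : Set (AU Λ F))}
      (scalarSubgroup Λ F) := by
  refine ⟨⟨scalarSubgroup_ne_top, inferInstance, AU.isClosed_scalarSubgroup⟩, ?_⟩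
  rintro N ⟨hne, hN, hclosed⟩ g hg
  by_contra hgZ
  exact hne (AU.eq_top_of_elementary_mem
    (fun _ _ hij c => AU.elementary_mem_of_notMem_scalarSubgroup hg hgZ hij c) hclosed)

theorem isTopologicallySimple_quotient_of_isGreatest {G : Type*} [Group G] [TopologicalSpace G]
    {Z : Subgroup G} [Z.Normal]
    (hZ : IsGreatest {N : Subgroup G | N ≠ ⊤ ∧ N.Normal ∧ IsClosed (N : Set G)} Z) :
    IsTopologicallySimple (G ⧸ Z) where
  nontrivial := QuotientGroup.nontrivial_iff.2 hZ.1.1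
  eq_bot_or_eq_top M hM hclosed := by
    have hmk := QuotientGroup.mk'_surjective Z
    rw [← Subgroup.map_comap_eq_self_of_surjective hmk M]
    by_cases htop : M.comap (QuotientGroup.mk' Z) = ⊤
    · exact .inr (by rw [htop, Subgroup.map_top_of_surjective _ hmk])
    · have hle := hZ.2 ⟨htop, hM.comap _, hclosed.preimage QuotientGroup.continuous_mk⟩
      left
      rwa [eq_bot_iff, Subgroup.map_le_iff_le_comap, MonoidHom.comap_bot, QuotientGroup.ker_mk']

end Main

theorem mainTheorem1_general {Λ F : Type*} [Preorder Λ] [ZLike Λ] [Infinite Λ]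
    [Field F] [TopologicalSpace F] [DiscreteTopology F] :
    (IsTopologicalGroup (AU Λ F) ∧ TotallyDisconnectedSpace (AU Λ F) ∧
      (Finite F → LocallyCompactSpace (AU Λ F))) ∧
    IsGreatest {N : Subgroup (AU Λ F) | N ≠ ⊤ ∧ N.Normal ∧ IsClosed (N : Set (AU Λ F))}
      (scalarSubgroup Λ F) ∧
    IsTopologicallySimple (AU Λ F ⧸ scalarSubgroup Λ F) :=
  ⟨⟨inferInstance, inferInstance, fun _ => inferInstance⟩, isGreatest_scalarSubgroup,
    isTopologicallySimple_quotient_of_isGreatest isGreatest_scalarSubgroup⟩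

theorem mainTheorem1 {Λ F : Type*} [Preorder Λ] [ZLike Λ] [Infinite Λ]
    [Field F] [Finite F] [TopologicalSpace F] [DiscreteTopology F] :
    (IsTopologicalGroup (AU Λ F) ∧ TotallyDisconnectedSpace (AU Λ F) ∧
      LocallyCompactSpace (AU Λ F)) ∧
    IsGreatest {N : Subgroup (AU Λ F) | N ≠ ⊤ ∧ N.Normal ∧ IsClosed (N : Set (AU Λ F))}
      (scalarSubgroup Λ F) ∧
    IsTopologicallySimple (AU Λ F ⧸ scalarSubgroup Λ F) :=
  mainTheorem1_general.imp_left (And.imp_right (And.imp_right fun h => h inferInstance))
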